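/- **Theorem 1.5.** *Conventions.* A bounded domain in $\mathbb C^d$ is a bounded, nonempty, connected open set $\Omega\subset\mathbb C^d$; $\|\cdot\|$ is the Euclidean norm; $\Delta\subset\mathbb C$ is the open unit disk; $\mathrm{Hol}(\Delta,\Omega)$ is the set of holomorphic maps $\Delta\to\Omega$; $\rho_\Delta(z,w)=\tanh^{-1}\left|\frac{z-w}{1-\overline w z}\right|$ is the Poincaré distance on $\Delta$; $\delta_\Omega(x)$ is the Euclidean distance from $x\in\Omega$ to $\partial\Omega$. The Kobayashi distance on $\Omega$ is $$K_\Omega(x,y)=\inf\sum_{i=1}^n\rho_\Delta(\zeta_{i-1},\zeta_i),$$ the infimum being over all $n\ge 1$, $\phi_1,\dots,\phi_n\in\mathrm{Hol}(\Delta,\Omega)$ and $\zeta_0,\dots,\zeta_n\in\Delta$ with $\phi_1(\zeta_0)=x$, $\phi_n(\zeta_n)=y$ and $\phi_i(\zeta_i)=\phi_{i+1}(\zeta_i)$ for $1\le i\le n-1$. The Kobayashi metric is, for $x\in\Omega$ and $v\in\mathbb C^d$, $$k_\Omega(x;v)=\inf\{|\xi| : \xi\in\mathbb C,\ \phi\in\mathrm{Hol}(\Delta,\Omega),\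 \phi(0)=x,\ \phi'(0)\xi=v\}.$$ Put $M_\Omega(r)=\sup\{1/k_\Omega(x;v) : x\in\Omega,\ \delta_\Omega(x)\le r,\ \|v\|=1\}$. A bounded domain $\Omega$ is a *Goldilocks domain* if 1. for some $\epsilon>0$, $\int_0^\epsilon \frac1r M_\Omega(r)\,dr<\infty$, and 2. for each $x_0\in\Omega$ there exist constants $C,\alpha>0$ such that $K_\Omega(x_0,x)\le C+\alpha\log\frac1{\delta_\Omega(x)}$ for all $x\in\Omega$. *Statement.* Let $\Omega\subset\mathbb C^d$ be a Goldilocks domain such that the metric space $(\Omega,K_\Omega)$ is Cauchy complete, and let $f:\Omega\to\Omega$ be $1$-Lipschitz with respect to $K_\Omega$, that is, $K_\Omega(f(x),f(y))\le K_\Omega(x,y)$ for all $x,y\in\Omega$. Then either 1. for every $x\in\Omega$ the orbit $\{f^n(x):n\in\mathbb N\}$ is relatively compact in $\Omega$; or 2. there exists $\xi\in\partial\Omega$ such that $\lim_{n\to\infty}f^n(x)=\xi$ for every $x\in\Omega$, this convergence being uniform on compact subsets of $\Omega$. Here $f^n$ is the $n$-fold iterate of $f$, and in (2) convergence is with respect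 to the Euclidean distance. -/

import Mathlib

open Set Filter Topology MeasureTheory
open scoped ENNReal

namespace Goldilocks

noncomputable section

/-- A bounded domain in `ℂ^d` (with the Euclidean norm): a bounded, nonempty, connected open set. -/
structure IsBoundedDomain {d : ℕ} (Ω : Set (EuclideanSpace ℂ (Fin d))) : Prop where
  isOpen : IsOpen Ω
  isConnected : IsConnected Ω
  isBounded : Bornology.IsBounded Ω

/-- The open unit disk in `ℂ`. -/
def disk : Set ℂ := Metric.ball 0 1

/-- `Hol(Δ, Ω)`: the map `φ` is holomorphic on the open unit disk `Δ` and maps `Δ` into `Ω`.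
(The values of `φ` off `Δ` are irrelevant.) -/
def IsHolDisk {d : ℕ} (Ω : Set (EuclideanSpace ℂ (Fin d)))
    (φ : ℂ → EuclideanSpace ℂ (Fin d)) : Prop :=
  DifferentiableOn ℂ φ disk ∧ MapsTo φ disk Ω

/-- The Poincaré distance `artanh |(z - w) / (1 - w̄ z)|` on the open unit disk, normalized so that
its infinitesimal form at `0` is `|v|`. -/
def poincareDist (z w : ℂ) : ℝ :=
  Real.artanh ‖(z - w) / (1 - (starRingEnd ℂ) w * z)‖

/-- `(φ₁, …, φₙ; ζ₀, …, ζₙ)`, `n ≥ 1`, is an analytic chain in `Ω` joining `x` to `y`.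
Only the values `φ i` for `1 ≤ i ≤ n` and `ζ i` for `i ≤ n` matter. -/
structure IsAnalyticChain {d : ℕ} (Ω : Set (EuclideanSpace ℂ (Fin d)))
    (x y : EuclideanSpace ℂ (Fin d)) (n : ℕ)
    (φ : ℕ → ℂ → EuclideanSpace ℂ (Fin d)) (ζ : ℕ → ℂ) : Prop where
  one_le : 1 ≤ n
  hol : ∀ i, 1 ≤ i → i ≤ n → IsHolDisk Ω (φ i)
  mem_disk : ∀ i, i ≤ n → ζ i ∈ disk
  start : φ 1 (ζ 0) = x
  finish : φ n (ζ n) = y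
  link : ∀ i, 1 ≤ i → i < n → φ i (ζ i) = φ (i + 1) (ζ i)

/-- The Kobayashi (pseudo-)distance `K_Ω`: the infimum of `∑ ρ_Δ(ζ_{i-1}, ζ_i)` over all analytic
chains in `Ω` joining `x` to `y`. (All these sums are nonnegative, and on a domain every two points
are joined by a chain, so that this is a genuine infimum.) -/
def kobayashiDist {d : ℕ} (Ω : Set (EuclideanSpace ℂ (Fin d)))
    (x y : EuclideanSpace ℂ (Fin d)) : ℝ :=
  sInf {s : ℝ | ∃ (n : ℕ) (φ : ℕ → ℂ → EuclideanSpace ℂ (Fin d)) (ζ : ℕ → ℂ),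
    IsAnalyticChain Ω x y n φ ζ ∧ s = ∑ i ∈ Finset.range n, poincareDist (ζ i) (ζ (i + 1))}

/-- The infinitesimal Kobayashi (Kobayashi–Royden) metric
`k_Ω(x; v) = inf {|ξ| : φ ∈ Hol(Δ, Ω), φ(0) = x, φ'(0) ξ = v}`. -/
def kobayashiMetric {d : ℕ} (Ω : Set (EuclideanSpace ℂ (Fin d)))
    (x v : EuclideanSpace ℂ (Fin d)) : ℝ :=
  sInf {s : ℝ | ∃ (φ : ℂ → EuclideanSpace ℂ (Fin d)) (ξ : ℂ),
    IsHolDisk Ω φ ∧ φ 0 = x ∧ ξ • deriv φ 0 = v ∧ s = ‖ξ‖}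

/-- `δ_Ω(x)`: the Euclidean distance from `x` to `∂Ω`. -/
def bdryDist {d : ℕ} (Ω : Set (EuclideanSpace ℂ (Fin d)))
    (x : EuclideanSpace ℂ (Fin d)) : ℝ :=
  Metric.infDist x (frontier Ω)

/-- `M_Ω(r) = sup {1 / k_Ω(x; v) : x ∈ Ω, δ_Ω(x) ≤ r, ‖v‖ = 1}`, as an element of `[0, ∞]`. -/
def growth {d : ℕ} (Ω : Set (EuclideanSpace ℂ (Fin d))) (r : ℝ) : ℝ≥0∞ :=
  ⨆ (x : EuclideanSpace ℂ (Fin d)) (v : EuclideanSpace ℂ (Fin d))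
    (_ : x ∈ Ω ∧ bdryDist Ω x ≤ r ∧ ‖v‖ = 1), (ENNReal.ofReal (kobayashiMetric Ω x v))⁻¹

/-- Goldilocks domains. -/
structure IsGoldilocks {d : ℕ} (Ω : Set (EuclideanSpace ℂ (Fin d))) : Prop where
  isBoundedDomain : IsBoundedDomain Ω
  integral_finite : ∃ ε : ℝ, 0 < ε ∧
    ∫⁻ r in Ioo (0 : ℝ) ε, ENNReal.ofReal (1 / r) * growth Ω r < ∞
  dist_le : ∀ x₀ ∈ Ω, ∃ C α : ℝ, 0 < C ∧ 0 < α ∧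
    ∀ x ∈ Ω, kobayashiDist Ω x₀ x ≤ C + α * Real.log (1 / bdryDist Ω x)

/-- `(Ω, K_Ω)` is Cauchy complete: every `K_Ω`-Cauchy sequence in `Ω` converges with respect to
`K_Ω` to a point of `Ω`. -/
def IsKobayashiComplete {d : ℕ} (Ω : Set (EuclideanSpace ℂ (Fin d))) : Prop :=
  ∀ u : ℕ → EuclideanSpace ℂ (Fin d), (∀ n, u n ∈ Ω) →
    (∀ ε : ℝ, 0 < ε → ∃ N : ℕ, ∀ m ≥ N, ∀ n ≥ N, kobayashiDist Ω (u m) (u n) < ε) →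
    ∃ x ∈ Ω, Tendsto (fun n => kobayashiDist Ω (u n) x) atTop (𝓝 0)

end

end Goldilocks

/-! The argument is Karlsson's for nonexpansive maps, fed by a visibility property of the domain.
Cauchy completeness makes `(Ω, K_Ω)` proper by Hopf–Rinow (`properSpace_of_length`,
`properSpace_kobayashi`). In a proper space Całka's theorem (`tendsto_dist_iterate_atTop`) leaves
two cases: every orbit is bounded, hence relatively compact, or some orbit escapes to infinity.

The geometry enters through `IsGoldilocks.exists_gromovProduct_le`. Join two points by an
almost-geodesic. Away from its deepest point, the logarithmic upper bound on `K_Ω` forces the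
boundary distance to decay exponentially in time; the Euclidean speed is at most `M_Ω` of that
distance, and the integral condition makes these speeds summable. So an almost-geodesic that stays
near the boundary has its endpoints close together, and one joining points far apart must go a
definite depth into `Ω`, which bounds their Gromov product.

Along an escaping orbit, consider record times, at which the distance to the base point exceeds all
earlier ones. Nonexpansiveness gives earlier but late orbit points a large Gromov product with the
record point, so the orbit is Euclidean Cauchy. Any other orbit stays at bounded `K_Ω`-distance from
it and therefore has the same limit. -/

namespace Goldilocks

/-! ### Proper metric spaces: escaping orbits and Hopf–Rinow -/

/-- **Całka's theorem**: in a proper metric space, an unbounded orbit of a nonexpansive map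
leaves every bounded set. -/
theorem tendsto_dist_iterate_atTop {X : Type*} [PseudoMetricSpace X] [ProperSpace X] {f : X → X}
    (hf : ∀ x y, dist (f x) (f y) ≤ dist x y) {o : X}
    (ho : ¬ Bornology.IsBounded (range fun n : ℕ => f^[n] o)) :
    Tendsto (fun n : ℕ => dist o (f^[n] o)) atTop atTop := by
  have hfn : ∀ (n : ℕ) x y, dist (f^[n] x) (f^[n] y) ≤ dist x y := by
    intro n
    induction n with
    | zero => intro x y; simp
    | succ n ih =>
      intro x y
      rw [Function.iterate_succ_apply', Function.iterate_succ_apply']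
      exact (hf _ _).trans (ih x y)
  by_contra hnt
  apply ho
  -- infinitely many returns to a ball
  obtain ⟨R, hR⟩ : ∃ R : ℝ, ∃ᶠ n : ℕ in atTop, dist o (f^[n] o) < R := by
    rw [tendsto_atTop] at hnt
    push Not at hnt
    obtain ⟨R, hR⟩ := hnt
    exact ⟨R, hR.mono fun n hn => by simpa using hn⟩
  obtain ⟨φ, hφ, hφR⟩ := extraction_of_frequently_atTop hR
  have hmem : ∀ n, f^[φ n] o ∈ Metric.closedBall o R := fun n => by
    rw [Metric.mem_closedBall, dist_comm]; exact (hφR n).le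
  obtain ⟨q, -, ψ, hψ, hlim⟩ := (isCompact_closedBall o R).tendsto_subseq hmem
  obtain ⟨N, hN⟩ := (Metric.tendsto_atTop.1 hlim) (1 / 4) (by norm_num)
  set p := f^[φ (ψ N)] o with hp
  -- Two orbit points within 1/4 of the cluster point `q` are within 1/2 of each other, so the orbit
  -- of `p` returns near `p` at arbitrarily late times.
  have hrec : ∀ m : ℕ, ∃ k > m, dist (f^[k] p) p < 1 / 2 := by
    intro m
    obtain ⟨j, hj, hjm⟩ : ∃ j ≥ N, m + φ (ψ N) < φ (ψ j) := by
      refine ⟨max N (m + φ (ψ N) + 1), le_max_left _ _, ?_⟩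
      calc m + φ (ψ N) < m + φ (ψ N) + 1 := Nat.lt_succ_self _
        _ ≤ max N (m + φ (ψ N) + 1) := le_max_right _ _
        _ ≤ _ := (hφ.comp hψ).id_le _
    refine ⟨φ (ψ j) - φ (ψ N), by omega, ?_⟩
    rw [hp, ← Function.iterate_add_apply, Nat.sub_add_cancel (by omega)]
    calc _ ≤ dist (f^[φ (ψ j)] o) q + dist q (f^[φ (ψ N)] o) := dist_triangle _ _ _
      _ < 1 / 4 + 1 / 4 := add_lt_add (hN j hj) (by rw [dist_comm]; exact hN N le_rfl)
      _ = 1 / 2 := by norm_num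
  -- bounded gaps between visits to the unit ball
  have htb : TotallyBounded ((range fun n : ℕ => f^[n] p) ∩ Metric.ball p 1) :=
    ((isCompact_closedBall p 1).totallyBounded).subset
      (inter_subset_right.trans Metric.ball_subset_closedBall)
  obtain ⟨t, hts, htf, htc⟩ :=
    Metric.finite_approx_of_totallyBounded htb (1 / 2) (by norm_num)
  have hgap : ∀ y ∈ t, ∃ k > 0, dist (f^[k] y) p < 1 / 2 := by
    intro y hy
    obtain ⟨⟨m, rfl⟩, -⟩ := hts hy
    obtain ⟨k, hk, hkp⟩ := hrec m
    refine ⟨k - m, by omega, ?_⟩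
    simpa only [← Function.iterate_add_apply, Nat.sub_add_cancel hk.le] using hkp
  choose! g hg0 hg using hgap
  obtain ⟨G, hG⟩ : ∃ G, ∀ y ∈ t, g y ≤ G := by
    obtain ⟨G, hG⟩ := (htf.image g).bddAbove
    exact ⟨G, fun y hy => hG (mem_image_of_mem g hy)⟩
  have hvisit : ∀ n : ℕ, ∃ i ≤ G, ∃ m, n = i + m ∧ dist (f^[m] p) p < 1 := by
    intro n
    induction n using Nat.strong_induction_on with
    | _ n ih =>
      rcases Nat.eq_zero_or_pos n with rfl | hn
      · exact ⟨0, Nat.zero_le _, 0, rfl, by simp⟩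
      obtain ⟨i, hi, m, hnm, hm⟩ := ih (n - 1) (by omega)
      by_cases hiG : i + 1 ≤ G
      · exact ⟨i + 1, hiG, m, by omega, hm⟩
      obtain ⟨y, hy, hmy⟩ := mem_iUnion₂.1 (htc ⟨⟨m, rfl⟩, Metric.mem_ball.2 hm⟩)
      have hgG := hG y hy
      have hg1 := hg0 y hy
      -- Here `i = G`. The visit `f^[m] p` lies within 1/2 of `y`, which comes within 1/2 of `p`
      -- after `g y ≤ G` steps; hence `g y + m ≤ n` is a later visit.
      refine ⟨i + 1 - g y, by omega, g y + m, by omega, ?_⟩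
      rw [Function.iterate_add_apply]
      calc _ ≤ dist (f^[g y] (f^[m] p)) (f^[g y] y) + dist (f^[g y] y) p := dist_triangle _ _ _
        _ < 1 / 2 + 1 / 2 := add_lt_add ((hfn _ _ _).trans_lt (Metric.mem_ball.1 hmy)) (hg y hy)
        _ = 1 := by norm_num
  have hbp : Bornology.IsBounded (range fun n : ℕ => f^[n] p) := by
    obtain ⟨D, hD⟩ : ∃ D, ∀ i ≤ G, dist (f^[i] p) p ≤ D := by
      obtain ⟨D, hD⟩ := ((Set.finite_Iic G).image fun i => dist (f^[i] p) p).bddAbove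
      exact ⟨D, fun i hi => hD (mem_image_of_mem _ hi)⟩
    refine (Metric.isBounded_closedBall (x := p) (r := 1 + D)).subset ?_
    rintro _ ⟨n, rfl⟩
    obtain ⟨i, hi, m, rfl, hm⟩ := hvisit n
    rw [Metric.mem_closedBall]
    simp only [Function.iterate_add_apply]
    exact (dist_triangle _ (f^[i] p) _).trans (add_le_add ((hfn _ _ _).trans hm.le) (hD i hi))
  refine (((Set.finite_Iio (φ (ψ N))).image fun n => f^[n] o).isBounded.union hbp).subset ?_
  rintro _ ⟨n, rfl⟩
  rcases lt_or_ge n (φ (ψ N)) with h | h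
  · exact Or.inl ⟨n, h, rfl⟩
  · refine Or.inr ⟨n - φ (ψ N), ?_⟩
    simp only [hp, ← Function.iterate_add_apply, Nat.sub_add_cancel h]

/-- **Hopf–Rinow**: a complete, locally compact metric space in which distances can be split
approximately is proper. -/
theorem properSpace_of_length {X : Type*} [PseudoMetricSpace X] [CompleteSpace X]
    [LocallyCompactSpace X]
    (hlen : ∀ (x y : X) (r s : ℝ), 0 ≤ r → 0 < s → dist x y < r + s →
      ∃ z, dist x z ≤ r ∧ dist z y < s) : ProperSpace X := by
  refine ⟨fun o R => ?_⟩
  by_contra hR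
  set S : Set ℝ := {r | 0 ≤ r ∧ IsCompact (Metric.closedBall o r)} with hS
  have hmono : ∀ {r s : ℝ}, r ≤ s → IsCompact (Metric.closedBall o s) →
      IsCompact (Metric.closedBall o r) := fun h hs =>
    hs.of_isClosed_subset Metric.isClosed_closedBall (Metric.closedBall_subset_closedBall h)
  -- A compact neighbourhood of the ball contains a thickening of it, and splitting distances puts a
  -- slightly larger ball inside that thickening.
  have hext : ∀ r : ℝ, 0 ≤ r → IsCompact (Metric.closedBall o r) →
      ∃ s > r, IsCompact (Metric.closedBall o s) := by
    intro r hr hc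
    obtain ⟨K, hK, hKr⟩ := exists_compact_superset hc
    obtain ⟨ε, hε, hεK⟩ := hc.exists_thickening_subset_open isOpen_interior hKr
    refine ⟨r + ε / 2, by linarith, hK.of_isClosed_subset Metric.isClosed_closedBall ?_⟩
    intro y hy
    obtain ⟨z, hz, hzy⟩ := hlen o y r ε hr hε (by
      rw [Metric.mem_closedBall, dist_comm] at hy; linarith)
    apply interior_subset
    apply hεK
    rw [Metric.mem_thickening_iff]
    exact ⟨z, by rwa [Metric.mem_closedBall, dist_comm], by rwa [dist_comm]⟩
  have hbd : ∀ r ∈ S, r < R := fun r hr => by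
    by_contra! h
    exact hR (hmono h hr.2)
  have h0 : (0 : ℝ) ∈ S := by
    refine ⟨le_rfl, ?_⟩
    obtain ⟨K, hK, hKo⟩ := exists_compact_mem_nhds o
    refine hK.closure.of_isClosed_subset Metric.isClosed_closedBall fun y hy => ?_
    apply subset_closure
    obtain ⟨ε, hε, hb⟩ := Metric.mem_nhds_iff.1 hKo
    apply hb
    rw [Metric.mem_closedBall] at hy
    exact Metric.mem_ball.2 (hy.trans_lt hε)
  have hba : BddAbove S := ⟨R, fun r hr => (hbd r hr).le⟩
  set T := sSup S with hT
  have hT0 : 0 ≤ T := le_csSup hba h0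
  -- The supremum is attained: every point of the ball of radius `T` is within `ε / 2` of a compact
  -- ball of radius just below `T`, so a finite net of the latter serves for both.
  have hcT : IsCompact (Metric.closedBall o T) := by
    rw [isCompact_iff_totallyBounded_isComplete]
    refine ⟨?_, Metric.isClosed_closedBall.isComplete⟩
    rw [Metric.totallyBounded_iff]
    intro ε hε
    rcases eq_or_lt_of_le hT0 with h | hTpos
    · rw [← h]
      exact Metric.totallyBounded_iff.1 h0.2.totallyBounded ε hε
    obtain ⟨r, hr, hrT⟩ := exists_lt_of_lt_csSup ⟨0, h0⟩
      (show max 0 (T - ε / 4) < T from max_lt hTpos (by linarith))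
    obtain ⟨t, ht, htc⟩ := Metric.totallyBounded_iff.1 hr.2.totallyBounded (ε / 2) (by linarith)
    refine ⟨t, ht, fun y hy => ?_⟩
    obtain ⟨z, hz, hzy⟩ := hlen o y r (ε / 2) hr.1 (by linarith) (by
      rw [Metric.mem_closedBall, dist_comm] at hy
      have := le_max_right 0 (T - ε / 4)
      linarith)
    obtain ⟨w, hw, hzw⟩ := mem_iUnion₂.1 (htc (show z ∈ Metric.closedBall o r by
      rwa [Metric.mem_closedBall, dist_comm]))
    refine mem_iUnion₂.2 ⟨w, hw, ?_⟩
    rw [Metric.mem_ball] at hzw ⊢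
    rw [dist_comm] at hzy
    linarith [dist_triangle y z w]
  obtain ⟨s, hs, hcs⟩ := hext T hT0 hcT
  exact absurd (le_csSup hba ⟨hT0.trans hs.le, hcs⟩) (not_le.2 hs)

/-! ### Disk automorphisms and the Poincaré distance -/

open ComplexConjugate

variable {d : ℕ} {Ω : Set (EuclideanSpace ℂ (Fin d))}

theorem mem_disk {z : ℂ} : z ∈ disk ↔ ‖z‖ < 1 := by simp [disk]

theorem isOpen_disk : IsOpen disk := Metric.isOpen_ball

theorem zero_mem_disk : (0 : ℂ) ∈ disk := by simp [mem_disk]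

/-- The automorphism `z ↦ (z + a) / (1 + ā z)` of the unit disk. -/
noncomputable def moebius (a z : ℂ) : ℂ := (z + a) / (1 + conj a * z)

theorem one_add_conj_mul_ne_zero {a z : ℂ} (ha : a ∈ disk) (hz : z ∈ disk) :
    1 + conj a * z ≠ 0 := by
  rw [mem_disk] at ha hz
  intro h
  have h1 : ‖conj a * z‖ = 1 := by
    rw [show conj a * z = -1 by linear_combination h]; simp
  rw [norm_mul, Complex.norm_conj] at h1
  nlinarith [norm_nonneg a, norm_nonneg z]

theorem norm_sq_complex (z : ℂ) : ((‖z‖ ^ 2 : ℝ) : ℂ) = z * conj z := by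
  rw [Complex.mul_conj, Complex.normSq_eq_norm_sq]

theorem norm_sub_div_lt_one {z w : ℂ} (hz : z ∈ disk) (hw : w ∈ disk) :
    ‖(z - w) / (1 - conj w * z)‖ < 1 := by
  have hne : 1 - conj w * z ≠ 0 := by
    have := one_add_conj_mul_ne_zero (a := -w) (z := z) (by simpa [mem_disk] using hw) hz
    simpa [sub_eq_add_neg] using this
  rw [norm_div, div_lt_one (norm_pos_iff.2 hne)]
  rw [mem_disk] at hz hw
  have key : ‖1 - conj w * z‖ ^ 2 - ‖z - w‖ ^ 2 = (1 - ‖z‖ ^ 2) * (1 - ‖w‖ ^ 2) := by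
    apply Complex.ofReal_injective
    rw [Complex.ofReal_sub, Complex.ofReal_mul, Complex.ofReal_sub, Complex.ofReal_sub,
      norm_sq_complex, norm_sq_complex, norm_sq_complex, norm_sq_complex]
    simp only [map_sub, map_one, map_mul, Complex.conj_conj, Complex.ofReal_one]
    ring
  have hpos : 0 < (1 - ‖z‖ ^ 2) * (1 - ‖w‖ ^ 2) :=
    mul_pos (by nlinarith [norm_nonneg z]) (by nlinarith [norm_nonneg w])
  exact lt_of_pow_lt_pow_left₀ 2 (norm_nonneg _) (by linarith)

theorem moebius_mem_disk {a z : ℂ} (ha : a ∈ disk) (hz : z ∈ disk) : moebius a z ∈ disk := by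
  have := norm_sub_div_lt_one (z := z) (w := -a) hz (by simpa [mem_disk] using ha)
  rw [mem_disk, moebius]
  simpa [sub_eq_add_neg] using this

theorem moebius_zero (a : ℂ) : moebius a 0 = a := by simp [moebius]

theorem moebius_neg_self (a : ℂ) : moebius (-a) a = 0 := by simp [moebius]

theorem moebius_neg_moebius {a z : ℂ} (ha : a ∈ disk) (hz : z ∈ disk) :
    moebius (-a) (moebius a z) = z := by
  have h1 := one_add_conj_mul_ne_zero ha hz
  have h2 := one_add_conj_mul_ne_zero (a := -a) (by simpa [mem_disk] using ha)
    (moebius_mem_disk ha hz)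
  have h3 : moebius a z * (1 + conj a * z) = z + a := div_mul_cancel₀ _ h1
  rw [show moebius (-a) (moebius a z) =
    (moebius a z + -a) / (1 + conj (-a) * moebius a z) from rfl, div_eq_iff h2, map_neg]
  linear_combination h3

theorem differentiableOn_moebius {a : ℂ} (ha : a ∈ disk) :
    DifferentiableOn ℂ (moebius a) disk := by
  intro z hz
  refine DifferentiableAt.differentiableWithinAt ?_
  unfold moebius
  exact (by fun_prop : DifferentiableAt ℂ (fun z => z + a) z).div (by fun_prop)
    (one_add_conj_mul_ne_zero ha hz)

theorem hasDerivAt_moebius_zero (a : ℂ) :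
    HasDerivAt (moebius a) ((1 - ‖a‖ ^ 2 : ℝ) : ℂ) 0 := by
  have h1 : HasDerivAt (fun z : ℂ => z + a) 1 0 := (hasDerivAt_id _).add_const _
  have h2 : HasDerivAt (fun z : ℂ => 1 + conj a * z) (conj a) 0 := by
    simpa using ((hasDerivAt_id (0 : ℂ)).const_mul (conj a)).const_add 1
  have h := h1.div h2 (by simp)
  refine h.congr_deriv ?_
  rw [Complex.ofReal_sub, norm_sq_complex]
  simp

theorem poincareDist_moebius {a z w : ℂ} (ha : a ∈ disk) (hz : z ∈ disk) (hw : w ∈ disk) :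
    poincareDist (moebius a z) (moebius a w) = poincareDist z w := by
  have hz1 := one_add_conj_mul_ne_zero ha hz
  have hw1 := one_add_conj_mul_ne_zero ha hw
  have hwc : 1 + a * conj w ≠ 0 := by
    intro h; apply hw1; have := congrArg conj h; simpa using this
  have hac : (1 - a * conj a) ≠ 0 := by
    rw [← norm_sq_complex]
    rw [mem_disk] at ha
    have : (1 : ℝ) - ‖a‖ ^ 2 ≠ 0 := by nlinarith [norm_nonneg a]
    exact_mod_cast this
  have h1 : moebius a z - moebius a w =
      (z - w) * (1 - a * conj a) / ((1 + conj a * z) * (1 + conj a * w)) := by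
    rw [moebius, moebius, div_sub_div _ _ hz1 hw1]; congr 1; ring
  have h2 : 1 - conj (moebius a w) * moebius a z =
      (1 - conj w * z) * (1 - a * conj a) / ((1 + conj a * z) * (1 + a * conj w)) := by
    rw [moebius, moebius, map_div₀]
    simp only [map_add, map_one, map_mul, Complex.conj_conj]
    rw [mul_comm (1 + conj a * z),
      div_mul_div_comm, one_sub_div (mul_ne_zero hwc hz1)]
    congr 1
    ring
  have h3 : ‖1 + a * conj w‖ = ‖1 + conj a * w‖ := by
    rw [← Complex.norm_conj]; simp
  unfold poincareDist
  congr 1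
  rw [h1, h2, norm_div, norm_div, norm_div, norm_div, norm_mul, norm_mul, norm_mul, norm_mul, h3]
  have e1 := norm_ne_zero_iff.2 hz1
  have e2 := norm_ne_zero_iff.2 hw1
  have e3 := norm_ne_zero_iff.2 hac
  rw [div_div_div_cancel_right₀ (mul_ne_zero e1 e2), mul_div_mul_right _ _ e3]

theorem poincareDist_comm (z w : ℂ) : poincareDist z w = poincareDist w z := by
  unfold poincareDist
  congr 1
  rw [norm_div, norm_div, norm_sub_rev z w, ← Complex.norm_conj (1 - _ * z)]
  simp [mul_comm]

theorem poincareDist_nonneg (z w : ℂ) : 0 ≤ poincareDist z w :=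
  Real.artanh_nonneg (norm_nonneg _)

theorem poincareDist_self (z : ℂ) : poincareDist z z = 0 := by simp [poincareDist]

/-! ### Analytic chains and the Kobayashi distance -/

/-- The lengths of the analytic chains joining `x` to `y`. -/
def chainLengths (Ω : Set (EuclideanSpace ℂ (Fin d))) (x y : EuclideanSpace ℂ (Fin d)) : Set ℝ :=
  {s : ℝ | ∃ (n : ℕ) (φ : ℕ → ℂ → EuclideanSpace ℂ (Fin d)) (ζ : ℕ → ℂ),
    IsAnalyticChain Ω x y n φ ζ ∧ s = ∑ i ∈ Finset.range n, poincareDist (ζ i) (ζ (i + 1))}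

theorem IsHolDisk.comp_moebius {φ : ℂ → EuclideanSpace ℂ (Fin d)} (hφ : IsHolDisk Ω φ) {a : ℂ}
    (ha : a ∈ disk) : IsHolDisk Ω (φ ∘ moebius a) :=
  have h : MapsTo (moebius a) disk disk := fun _ hz => moebius_mem_disk ha hz
  ⟨hφ.1.comp (differentiableOn_moebius ha) h, hφ.2.comp h⟩

/-- Precomposing all disks of a chain with a Möbius map moves the base points. -/
theorem IsAnalyticChain.moebius {x y : EuclideanSpace ℂ (Fin d)} {n : ℕ}
    {φ : ℕ → ℂ → EuclideanSpace ℂ (Fin d)} {ζ : ℕ → ℂ} (h : IsAnalyticChain Ω x y n φ ζ) {a : ℂ}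
    (ha : a ∈ disk) :
    IsAnalyticChain Ω x y n (fun i => φ i ∘ moebius a) (fun i => Goldilocks.moebius (-a) (ζ i)) where
  one_le := h.one_le
  hol i hi hin := (h.hol i hi hin).comp_moebius ha
  mem_disk i hi := moebius_mem_disk (by simpa [Goldilocks.mem_disk] using ha) (h.mem_disk i hi)
  start := by
    have := moebius_neg_moebius (a := -a) (by simpa [Goldilocks.mem_disk] using ha)
      (h.mem_disk 0 (Nat.zero_le _))
    rw [neg_neg] at this
    simp [this, h.start]
  finish := by
    have := moebius_neg_moebius (a := -a) (by simpa [Goldilocks.mem_disk] using ha)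
      (h.mem_disk n le_rfl)
    rw [neg_neg] at this
    simp [this, h.finish]
  link i hi hin := by
    have := moebius_neg_moebius (a := -a) (by simpa [Goldilocks.mem_disk] using ha)
      (h.mem_disk i hin.le)
    rw [neg_neg] at this
    simp [this, h.link i hi hin]

theorem IsAnalyticChain.sum_moebius {x y : EuclideanSpace ℂ (Fin d)} {n : ℕ}
    {φ : ℕ → ℂ → EuclideanSpace ℂ (Fin d)} {ζ : ℕ → ℂ} (h : IsAnalyticChain Ω x y n φ ζ) {a : ℂ}
    (ha : a ∈ disk) :
    ∑ i ∈ Finset.range n, poincareDist (Goldilocks.moebius (-a) (ζ i))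
      (Goldilocks.moebius (-a) (ζ (i + 1))) =
    ∑ i ∈ Finset.range n, poincareDist (ζ i) (ζ (i + 1)) := by
  refine Finset.sum_congr rfl fun i hi => ?_
  have := Finset.mem_range.1 hi
  exact poincareDist_moebius (by simpa [Goldilocks.mem_disk] using ha) (h.mem_disk _ (by omega))
    (h.mem_disk _ (by omega))

/-- Consecutive disks of a chain share the parameter at their joint. Both chains are therefore first
moved by disk automorphisms, which preserve lengths, so that the joint sits at parameter 0 in each.
-/
theorem add_mem_chainLengths {x y z : EuclideanSpace ℂ (Fin d)} {s t : ℝ}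
    (hs : s ∈ chainLengths Ω x y) (ht : t ∈ chainLengths Ω y z) :
    s + t ∈ chainLengths Ω x z := by
  obtain ⟨n, φ, ζ, hc, rfl⟩ := hs
  obtain ⟨m, ψ, η, hd, rfl⟩ := ht
  rw [← hc.sum_moebius (hc.mem_disk n le_rfl), ← hd.sum_moebius (hd.mem_disk 0 (Nat.zero_le _))]
  have hc' := hc.moebius (hc.mem_disk n le_rfl)
  have hd' := hd.moebius (hd.mem_disk 0 (Nat.zero_le _))
  have hc0 := moebius_neg_self (ζ n)
  have hd0 := moebius_neg_self (η 0)
  set φ' := fun i => φ i ∘ moebius (ζ n)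
  set ψ' := fun i => ψ i ∘ moebius (η 0)
  set ζ' := fun i => moebius (-ζ n) (ζ i) with hζ'
  set η' := fun i => moebius (-η 0) (η i) with hη'
  replace hc0 : ζ' n = 0 := hc0
  replace hd0 : η' 0 = 0 := hd0
  have hn := hc'.one_le
  have hm := hd'.one_le
  refine ⟨n + m, fun i => if i ≤ n then φ' i else ψ' (i - n),
    fun i => if i ≤ n then ζ' i else η' (i - n), ?_, ?_⟩
  · refine ⟨by omega, fun i hi him => ?_, fun i him => ?_, ?_, ?_, fun i hi him => ?_⟩
    · split_ifs with h
      · exact hc'.hol i hi h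
      · exact hd'.hol (i - n) (by omega) (by omega)
    · split_ifs with h
      · exact hc'.mem_disk i h
      · exact hd'.mem_disk (i - n) (by omega)
    · simpa [hn] using hc'.start
    · have : ¬ n + m ≤ n := by omega
      simpa [this] using hd'.finish
    · rcases lt_trichotomy i n with h | rfl | h
      · simpa [h.le, Nat.succ_le_of_lt h] using hc'.link i hi h
      · have e1 := hc'.finish
        have e2 := hd'.start
        rw [hd0] at e2
        rw [hc0] at e1
        simp [hc0, e1, e2]
      · have e := hd'.link (i - n) (by omega) (by omega)
        have h1 : ¬ i ≤ n := by omega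
        have h2 : ¬ i + 1 ≤ n := by omega
        rw [show i - n + 1 = i + 1 - n by omega] at e
        simpa [h1, h2] using e
  · rw [Finset.sum_range_add]
    congr 1
    · refine Finset.sum_congr rfl fun i hi => ?_
      have := Finset.mem_range.1 hi
      simp [this.le, Nat.succ_le_of_lt this, hζ']
    · refine Finset.sum_congr rfl fun i hi => ?_
      have h2 : ¬ n + i + 1 ≤ n := by omega
      rcases Nat.eq_zero_or_pos i with rfl | h
      · simp [hc0, ← hd0, hη']
      · have h1 : ¬ n + i ≤ n := by omega
        simp [h1, h2, hη', show n + i + 1 - n = i + 1 by omega]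

theorem mem_chainLengths_symm {x y : EuclideanSpace ℂ (Fin d)} {s : ℝ}
    (hs : s ∈ chainLengths Ω x y) : s ∈ chainLengths Ω y x := by
  obtain ⟨n, φ, ζ, hc, rfl⟩ := hs
  have hn := hc.one_le
  refine ⟨n, fun i => φ (n + 1 - i), fun i => ζ (n - i), ⟨hn, fun i hi hin => ?_, fun i hi => ?_,
    ?_, ?_, fun i hi hin => ?_⟩, ?_⟩
  · exact hc.hol _ (by omega) (by omega)
  · exact hc.mem_disk _ (by omega)
  · simpa using hc.finish
  · simpa using hc.start
  · have := hc.link (n - i) (by omega) (by omega)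
    rw [show n + 1 - i = n - i + 1 by omega, show n + 1 - (i + 1) = n - i by omega, this]
  · rw [← Finset.sum_range_reflect]
    refine Finset.sum_congr rfl fun i hi => ?_
    have := Finset.mem_range.1 hi
    rw [poincareDist_comm, show n - 1 - i + 1 = n - i by omega, show n - 1 - i = n - (i + 1) by omega]

theorem poincareDist_mem_chainLengths {φ : ℂ → EuclideanSpace ℂ (Fin d)} (hφ : IsHolDisk Ω φ)
    {z w : ℂ} (hz : z ∈ disk) (hw : w ∈ disk) :
    poincareDist z w ∈ chainLengths Ω (φ z) (φ w) := by
  refine ⟨1, fun _ => φ, fun i => if i = 0 then z else w, ⟨le_rfl, fun _ _ _ => hφ, fun i _ => ?_,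
    by simp, by simp, fun i hi hi' => by omega⟩, by simp⟩
  split_ifs
  exacts [hz, hw]

theorem nonneg_of_mem_chainLengths {x y : EuclideanSpace ℂ (Fin d)} {s : ℝ}
    (hs : s ∈ chainLengths Ω x y) : 0 ≤ s := by
  obtain ⟨n, φ, ζ, -, rfl⟩ := hs
  exact Finset.sum_nonneg fun i _ => poincareDist_nonneg _ _

theorem bddBelow_chainLengths (x y : EuclideanSpace ℂ (Fin d)) : BddBelow (chainLengths Ω x y) :=
  ⟨0, fun _ => nonneg_of_mem_chainLengths⟩

theorem kobayashiDist_le_of_mem {x y : EuclideanSpace ℂ (Fin d)} {s : ℝ}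
    (hs : s ∈ chainLengths Ω x y) : kobayashiDist Ω x y ≤ s :=
  csInf_le (bddBelow_chainLengths x y) hs

theorem kobayashiDist_nonneg (x y : EuclideanSpace ℂ (Fin d)) : 0 ≤ kobayashiDist Ω x y :=
  Real.sInf_nonneg fun _ => nonneg_of_mem_chainLengths

theorem kobayashiDist_comm (x y : EuclideanSpace ℂ (Fin d)) :
    kobayashiDist Ω x y = kobayashiDist Ω y x := by
  have : chainLengths Ω x y = chainLengths Ω y x :=
    Set.ext fun _ => ⟨mem_chainLengths_symm, mem_chainLengths_symm⟩
  exact congrArg sInf this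

theorem isHolDisk_const {x : EuclideanSpace ℂ (Fin d)} (hx : x ∈ Ω) : IsHolDisk Ω fun _ => x :=
  ⟨differentiableOn_const _, fun _ _ => hx⟩

theorem zero_mem_chainLengths {x : EuclideanSpace ℂ (Fin d)} (hx : x ∈ Ω) :
    0 ∈ chainLengths Ω x x := by
  rw [← poincareDist_self 0]
  exact poincareDist_mem_chainLengths (isHolDisk_const hx) zero_mem_disk zero_mem_disk

theorem kobayashiDist_self {x : EuclideanSpace ℂ (Fin d)} (hx : x ∈ Ω) :
    kobayashiDist Ω x x = 0 :=
  le_antisymm (kobayashiDist_le_of_mem (zero_mem_chainLengths hx)) (kobayashiDist_nonneg _ _)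

/-- The affine disk centred at `x` in direction `v`. -/
theorem isHolDisk_affine {x v : EuclideanSpace ℂ (Fin d)}
    (h : Metric.closedBall x ‖v‖ ⊆ Ω) : IsHolDisk Ω fun z : ℂ => x + z • v := by
  refine ⟨by fun_prop, fun z hz => h ?_⟩
  rw [mem_disk] at hz
  rw [mem_closedBall_iff_norm, add_sub_cancel_left, norm_smul]
  nlinarith [norm_nonneg v]

/-- The chain is a single affine disk of radius `r` centred at `x` and passing through `y`. -/
theorem exists_mem_chainLengths_of_dist_lt {x y : EuclideanSpace ℂ (Fin d)} {r : ℝ} (hr : 0 < r)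
    (h : Metric.closedBall x r ⊆ Ω) (hy : ‖y - x‖ < r) :
    Real.artanh (‖y - x‖ / r) ∈ chainLengths Ω x y := by
  rcases eq_or_ne y x with rfl | hne
  · simpa using zero_mem_chainLengths (h (Metric.mem_closedBall_self hr.le))
  have hpos : 0 < ‖y - x‖ := norm_pos_iff.2 (sub_ne_zero.2 hne)
  set v : EuclideanSpace ℂ (Fin d) := ((r / ‖y - x‖ : ℝ) : ℂ) • (y - x) with hv
  have hvn : ‖v‖ = r := by
    rw [hv, norm_smul, Complex.norm_real, Real.norm_of_nonneg (by positivity)]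
    field_simp
  have hw : ((‖y - x‖ / r : ℝ) : ℂ) ∈ disk := by
    rw [mem_disk, Complex.norm_real, Real.norm_of_nonneg (by positivity)]
    exact (div_lt_one hr).2 hy
  have := poincareDist_mem_chainLengths (isHolDisk_affine (x := x) (v := v) (hvn ▸ h))
    zero_mem_disk hw
  have e : poincareDist 0 ((‖y - x‖ / r : ℝ) : ℂ) = Real.artanh (‖y - x‖ / r) := by
    rw [poincareDist]
    simp only [zero_sub, mul_zero, sub_zero, div_one, norm_neg, Complex.norm_real]
    rw [Real.norm_of_nonneg (by positivity)]
  have e2 : x + ((‖y - x‖ / r : ℝ) : ℂ) • v = y := by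
    rw [hv, smul_smul, ← Complex.ofReal_mul, show ‖y - x‖ / r * (r / ‖y - x‖) = 1 by field_simp]
    simp
  simpa only [e, e2, zero_smul, add_zero] using this

theorem kobayashiDist_lt_of_dist_lt {x y : EuclideanSpace ℂ (Fin d)} {r ε : ℝ} (hr : 0 < r)
    (h : Metric.closedBall x r ⊆ Ω) (hy : ‖y - x‖ < r * Real.tanh ε) :
    kobayashiDist Ω x y < ε := by
  have h1 : ‖y - x‖ / r < Real.tanh ε := (div_lt_iff₀' hr).2 hy
  have h2 := Real.tanh_lt_one ε
  refine (kobayashiDist_le_of_mem (exists_mem_chainLengths_of_dist_lt hr h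
    (by nlinarith))).trans_lt ?_
  rw [← Real.artanh_tanh ε]
  exact Real.artanh_lt_artanh (by linarith [div_nonneg (norm_nonneg (y - x)) hr.le]) h2 h1

/-- The set of points reachable from `x` is open and relatively closed in the connected set `Ω`.
Nonemptiness matters because `sInf ∅ = 0` in `ℝ`: without it, `kobayashiDist` could vanish for lack
of chains. -/
theorem chainLengths_nonempty (hΩ : IsBoundedDomain Ω) {x y : EuclideanSpace ℂ (Fin d)}
    (hx : x ∈ Ω) (hy : y ∈ Ω) : (chainLengths Ω x y).Nonempty := by
  have hball : ∀ z ∈ Ω, ∃ r > 0, Metric.closedBall z r ⊆ Ω := fun z hz =>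
    Metric.nhds_basis_closedBall.mem_iff.1 (hΩ.isOpen.mem_nhds hz)
  have hnear : ∀ z ∈ Ω, ∃ r > 0, ∀ w ∈ Metric.ball z r, w ∈ Ω ∧ (chainLengths Ω z w).Nonempty := by
    intro z hz
    obtain ⟨r, hr, hrΩ⟩ := hball z hz
    refine ⟨r, hr, fun w hw => ⟨hrΩ (Metric.ball_subset_closedBall hw),
      _, exists_mem_chainLengths_of_dist_lt hr hrΩ (mem_ball_iff_norm.1 hw)⟩⟩
  set U := {z | z ∈ Ω ∧ (chainLengths Ω x z).Nonempty} with hU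
  have hUo : IsOpen U := by
    rw [Metric.isOpen_iff]
    rintro z ⟨hz, s, hs⟩
    obtain ⟨r, hr, h⟩ := hnear z hz
    refine ⟨r, hr, fun w hw => ?_⟩
    obtain ⟨hwΩ, t, ht⟩ := h w hw
    exact ⟨hwΩ, _, add_mem_chainLengths hs ht⟩
  refine (hΩ.isConnected.isPreconnected.subset_of_closure_inter_subset hUo
    ⟨x, hx, hx, 0, zero_mem_chainLengths hx⟩ ?_ hy).2
  rintro z ⟨hzc, hz⟩
  obtain ⟨r, hr, h⟩ := hnear z hz
  obtain ⟨w, ⟨-, s, hs⟩, hzw⟩ := Metric.mem_closure_iff.1 hzc r hr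
  obtain ⟨-, t, ht⟩ := h w (by rwa [Metric.mem_ball, dist_comm])
  exact ⟨hz, _, add_mem_chainLengths hs (mem_chainLengths_symm ht)⟩

theorem exists_chainLength_lt (hΩ : IsBoundedDomain Ω) {x y : EuclideanSpace ℂ (Fin d)}
    (hx : x ∈ Ω) (hy : y ∈ Ω) {c : ℝ} (h : kobayashiDist Ω x y < c) :
    ∃ s ∈ chainLengths Ω x y, s < c :=
  exists_lt_of_csInf_lt (chainLengths_nonempty hΩ hx hy) h

theorem kobayashiDist_triangle (hΩ : IsBoundedDomain Ω) {x y z : EuclideanSpace ℂ (Fin d)}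
    (hx : x ∈ Ω) (hy : y ∈ Ω) (hz : z ∈ Ω) :
    kobayashiDist Ω x z ≤ kobayashiDist Ω x y + kobayashiDist Ω y z := by
  refine le_of_forall_pos_le_add fun ε hε => ?_
  obtain ⟨s, hs, hs'⟩ := exists_chainLength_lt hΩ hx hy
    (lt_add_of_pos_right (kobayashiDist Ω x y) (half_pos hε))
  obtain ⟨t, ht, ht'⟩ := exists_chainLength_lt hΩ hy hz
    (lt_add_of_pos_right (kobayashiDist Ω y z) (half_pos hε))
  linarith [kobayashiDist_le_of_mem (add_mem_chainLengths hs ht)]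

/-! ### Bounds involving the growth function -/

theorem growth_mono {r s : ℝ} (h : r ≤ s) : growth Ω r ≤ growth Ω s := by
  refine iSup_mono fun x => iSup_mono fun v => iSup_mono' fun hx => ?_
  exact ⟨⟨hx.1, hx.2.1.trans h, hx.2.2⟩, le_rfl⟩

/-- The disk itself competes in the infimum defining the metric in the direction of its derivative,
with `ξ` the inverse of the norm of that derivative. -/
theorem ofReal_norm_deriv_le_growth {φ : ℂ → EuclideanSpace ℂ (Fin d)} (hφ : IsHolDisk Ω φ) :
    ENNReal.ofReal ‖deriv φ 0‖ ≤ growth Ω (bdryDist Ω (φ 0)) := by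
  set v := deriv φ 0 with hv
  rcases eq_or_ne v 0 with h0 | h0
  · simp [h0]
  have hpos : 0 < ‖v‖ := norm_pos_iff.2 h0
  set u : EuclideanSpace ℂ (Fin d) := ((‖v‖⁻¹ : ℝ) : ℂ) • v with hu
  have hun : ‖u‖ = 1 := by
    rw [hu, norm_smul, Complex.norm_real, Real.norm_of_nonneg (by positivity)]
    field_simp
  have hk : kobayashiMetric Ω (φ 0) u ≤ ‖v‖⁻¹ := by
    refine csInf_le ⟨0, ?_⟩ ⟨φ, ((‖v‖⁻¹ : ℝ) : ℂ), hφ, rfl, rfl, ?_⟩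
    · rintro _ ⟨_, ξ, -, -, -, rfl⟩
      exact norm_nonneg ξ
    · rw [Complex.norm_real, Real.norm_of_nonneg (by positivity)]
  have h1 : (ENNReal.ofReal (kobayashiMetric Ω (φ 0) u))⁻¹ ≤ growth Ω (bdryDist Ω (φ 0)) :=
    le_iSup_of_le (φ 0) (le_iSup_of_le u
      (le_iSup_of_le ⟨hφ.2 zero_mem_disk, le_rfl, hun⟩ le_rfl))
  refine le_trans ?_ h1
  rw [ENNReal.le_inv_iff_le_inv, ← ENNReal.ofReal_inv_of_pos hpos]
  exact ENNReal.ofReal_le_ofReal hk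

/-- On a bounded domain the function `M_Ω` is bounded. -/
theorem exists_growth_le (hΩ : IsBoundedDomain Ω) :
    ∃ R : ℝ, 0 < R ∧ ∀ r, growth Ω r ≤ ENNReal.ofReal R := by
  obtain ⟨R, hR⟩ := Metric.isBounded_iff.1 hΩ.isBounded
  refine ⟨max R 1, by positivity, fun r => iSup_le fun x => iSup_le fun v => iSup_le ?_⟩
  rintro ⟨hx, -, hv⟩
  rw [ENNReal.inv_le_iff_inv_le, ← ENNReal.ofReal_inv_of_pos (by positivity)]
  refine ENNReal.ofReal_le_ofReal (le_csInf ?_ ?_)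
  · obtain ⟨ρ, hρ, hρΩ⟩ := Metric.nhds_basis_closedBall.mem_iff.1 (hΩ.isOpen.mem_nhds hx)
    refine ⟨_, fun z => x + z • ((ρ : ℂ) • v), (ρ : ℂ)⁻¹, isHolDisk_affine ?_, by simp, ?_, rfl⟩
    · rwa [norm_smul, hv, mul_one, Complex.norm_real, Real.norm_of_nonneg hρ.le]
    · have : HasDerivAt (fun z : ℂ => x + z • ((ρ : ℂ) • v)) ((1 : ℂ) • ((ρ : ℂ) • v)) 0 :=
        ((hasDerivAt_id (0 : ℂ)).smul_const _).const_add x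
      rw [this.deriv, one_smul, smul_smul, inv_mul_cancel₀, one_smul]
      exact_mod_cast hρ.ne'
  · rintro _ ⟨φ, ξ, hφ, -, hξ, rfl⟩
    -- Cauchy's estimate: the image of the disk lies within `max R 1` of its centre.
    have h1 : ‖deriv φ 0‖ ≤ max R 1 := by
      have := Complex.norm_deriv_le_div_of_mapsTo_ball (R₂ := max R 1) hφ.1 (fun z hz =>
        Metric.mem_closedBall.2 ((hR (hφ.2 hz) (hφ.2 zero_mem_disk)).trans (le_max_left _ _)))
        one_pos
      simpa using this
    rw [← hξ, norm_smul] at hv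
    rw [inv_le_iff_one_le_mul₀ (by positivity)]
    exact hv.symm.le.trans (mul_le_mul_of_nonneg_left h1 (norm_nonneg _))

/-! ### From chains to curves of controlled speed -/

/-- A curve `σ : [0, L] → Ω` which is `1`-Lipschitz for the Kobayashi distance and whose Euclidean
speed is controlled by `M_Ω`. -/
structure IsChainCurve (Ω : Set (EuclideanSpace ℂ (Fin d))) (σ : ℝ → EuclideanSpace ℂ (Fin d))
    (L : ℝ) : Prop where
  nonneg : 0 ≤ L
  mem : ∀ t, 0 ≤ t → t ≤ L → σ t ∈ Ω
  kobayashiDist_le : ∀ a b, 0 ≤ a → a ≤ b → b ≤ L → kobayashiDist Ω (σ a) (σ b) ≤ b - a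
  norm_sub_le : ∀ a b C, 0 ≤ a → a ≤ b → b ≤ L → 0 ≤ C →
    (∀ t ∈ Icc a b, growth Ω (bdryDist Ω (σ t)) ≤ ENNReal.ofReal C) → ‖σ b - σ a‖ ≤ C * (b - a)

theorem hasDerivAt_tanh (t : ℝ) : HasDerivAt Real.tanh (1 - Real.tanh t ^ 2) t := by
  have hc := (Real.cosh_pos t).ne'
  have h := (Real.hasDerivAt_sinh t).div (Real.hasDerivAt_cosh t) hc
  have e : Real.tanh = fun t => Real.sinh t / Real.cosh t :=
    funext Real.tanh_eq_sinh_div_cosh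
  rw [e]
  refine h.congr_deriv ?_
  field_simp

theorem ofReal_tanh_mem_disk (t : ℝ) : ((Real.tanh t : ℝ) : ℂ) ∈ disk := by
  rw [mem_disk, Complex.norm_real, Real.norm_eq_abs, abs_lt]
  exact ⟨Real.neg_one_lt_tanh t, Real.tanh_lt_one t⟩

theorem poincareDist_tanh {a b : ℝ} (hab : a ≤ b) :
    poincareDist (Real.tanh a : ℝ) (Real.tanh b : ℝ) = b - a := by
  have e : (Real.tanh a - Real.tanh b) / (1 - Real.tanh b * Real.tanh a) = Real.tanh (a - b) := by
    have ha := (Real.cosh_pos a).ne'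
    have hb := (Real.cosh_pos b).ne'
    have hab := Real.cosh_pos (a - b)
    rw [Real.cosh_sub] at hab
    have hd : 1 - Real.sinh b / Real.cosh b * (Real.sinh a / Real.cosh a) =
        (Real.cosh a * Real.cosh b - Real.sinh a * Real.sinh b) / (Real.cosh a * Real.cosh b) := by
      field_simp
    rw [Real.tanh_eq_sinh_div_cosh, Real.tanh_eq_sinh_div_cosh, Real.tanh_eq_sinh_div_cosh,
      Real.sinh_sub, Real.cosh_sub, hd, div_sub_div _ _ ha hb,
      div_div_div_cancel_right₀ (mul_ne_zero ha hb)]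
  rw [poincareDist, Complex.conj_ofReal]
  have : ((Real.tanh a : ℝ) - (Real.tanh b : ℝ) : ℂ) / (1 - (Real.tanh b : ℝ) * (Real.tanh a : ℝ))
      = ((Real.tanh (a - b) : ℝ) : ℂ) := by
    rw [← e]; push_cast; rfl
  rw [this, Complex.norm_real, Real.norm_eq_abs, abs_of_nonpos, ← Real.tanh_neg, Real.artanh_tanh]
  · ring
  · rw [Real.tanh_eq_sinh_div_cosh]
    exact div_nonpos_of_nonpos_of_nonneg (Real.sinh_nonpos_iff.2 (by linarith))
      (Real.cosh_pos _).le

/-- `Real.tanh` is the unit-speed hyperbolic geodesic. Recentring the disk at `tanh t` turns the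
velocity there into a derivative at 0, which `ofReal_norm_deriv_le_growth` bounds. -/
theorem isChainCurve_tanh {φ : ℂ → EuclideanSpace ℂ (Fin d)} (hφ : IsHolDisk Ω φ) {L : ℝ}
    (hL : 0 ≤ L) : IsChainCurve Ω (fun t => φ (Real.tanh t : ℝ)) L where
  nonneg := hL
  mem t _ _ := hφ.2 (ofReal_tanh_mem_disk t)
  kobayashiDist_le a b _ hab _ := by
    rw [← poincareDist_tanh hab]
    exact kobayashiDist_le_of_mem (poincareDist_mem_chainLengths hφ (ofReal_tanh_mem_disk a)
      (ofReal_tanh_mem_disk b))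
  norm_sub_le a b C ha hab hb hC h := by
    have hder : ∀ t : ℝ, HasDerivAt (fun t : ℝ => φ (Real.tanh t : ℝ))
        (((1 - Real.tanh t ^ 2 : ℝ) : ℂ) • deriv φ (Real.tanh t : ℝ)) t := fun t =>
      HasDerivAt.scomp (𝕜' := ℂ) t ((hφ.1.differentiableAt
        (isOpen_disk.mem_nhds (ofReal_tanh_mem_disk t))).hasDerivAt)
        (hasDerivAt_tanh t).ofReal_comp
    refine norm_image_sub_le_of_norm_deriv_le_segment' (fun t _ => (hder t).hasDerivWithinAt)
      (fun t ht => ?_) b (right_mem_Icc.2 hab)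
    have hd := hφ.comp_moebius (ofReal_tanh_mem_disk t)
    have e : deriv (φ ∘ moebius (Real.tanh t : ℝ)) 0 =
        ((1 - Real.tanh t ^ 2 : ℝ) : ℂ) • deriv φ (Real.tanh t : ℝ) := by
      have h1 := hasDerivAt_moebius_zero ((Real.tanh t : ℝ) : ℂ)
      rw [Complex.norm_real, Real.norm_eq_abs, sq_abs] at h1
      refine (HasDerivAt.scomp (𝕜' := ℂ) 0 ?_ h1).deriv
      rw [moebius_zero]
      exact (hφ.1.differentiableAt
        (isOpen_disk.mem_nhds (ofReal_tanh_mem_disk t))).hasDerivAt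
    have h2 := ofReal_norm_deriv_le_growth hd
    rw [e, Function.comp_apply, moebius_zero] at h2
    exact (ENNReal.ofReal_le_ofReal_iff hC).1 (h2.trans (h t (Ico_subset_Icc_self ht)))

/-- A Möbius map brings `z` to 0 and the rotation by `e` brings `w` to the positive real axis, where
the `tanh` curve applies. -/
theorem exists_isChainCurve_of_isHolDisk {φ : ℂ → EuclideanSpace ℂ (Fin d)} (hφ : IsHolDisk Ω φ)
    {z w : ℂ} (hz : z ∈ disk) (hw : w ∈ disk) :
    ∃ σ, IsChainCurve Ω σ (poincareDist z w) ∧ σ 0 = φ z ∧ σ (poincareDist z w) = φ w := by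
  have hz' : -z ∈ disk := by simpa [mem_disk] using hz
  set u := moebius (-z) w with hu
  have hud : u ∈ disk := moebius_mem_disk hz' hw
  have hρ : poincareDist z w = Real.artanh ‖u‖ := by
    rw [← poincareDist_moebius hz' hz hw, moebius_neg_self, ← hu]
    simp [poincareDist]
  have hzu : moebius z u = w := by
    have := moebius_neg_moebius hz' hw
    rwa [neg_neg] at this
  set e := Complex.exp (u.arg * Complex.I) with he
  have hen : ‖e‖ = 1 := Complex.norm_exp_ofReal_mul_I _
  have heu : ‖u‖ * e = u := Complex.norm_mul_exp_arg_mul_I u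
  have hψ : IsHolDisk Ω fun s => (φ ∘ moebius z) (s * e) := by
    have hm : MapsTo (fun s : ℂ => s * e) disk disk := fun s hs => by
      rw [mem_disk] at hs ⊢
      rwa [norm_mul, hen, mul_one]
    have h := hφ.comp_moebius hz
    exact ⟨h.1.comp (by fun_prop) hm, h.2.comp hm⟩
  have hu1 : ‖u‖ ∈ Ioo (-1 : ℝ) 1 :=
    ⟨by linarith [norm_nonneg u], mem_disk.1 hud⟩
  refine ⟨_, isChainCurve_tanh hψ (poincareDist_nonneg z w), by simp [moebius_zero], ?_⟩
  simp only [hρ, Real.tanh_artanh hu1, heu, Function.comp_apply, hzu]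

theorem IsChainCurve.reverse {σ : ℝ → EuclideanSpace ℂ (Fin d)} {L : ℝ}
    (h : IsChainCurve Ω σ L) : IsChainCurve Ω (fun t => σ (L - t)) L where
  nonneg := h.nonneg
  mem t h0 hL := h.mem _ (by linarith) (by linarith)
  kobayashiDist_le a b ha hab hb := by
    rw [kobayashiDist_comm]
    exact (h.kobayashiDist_le _ _ (by linarith) (by linarith) (by linarith)).trans_eq (by ring)
  norm_sub_le a b C ha hab hb hC hg := by
    rw [norm_sub_rev]
    refine (h.norm_sub_le (L - b) (L - a) C (by linarith) (by linarith) (by linarith) hC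
      fun t ht => ?_).trans_eq (by ring)
    have := hg (L - t) ⟨by linarith [ht.2], by linarith [ht.1]⟩
    rwa [sub_sub_cancel] at this

/-- The speed bound concerns increments, not derivatives, so it adds up across the corner at time
`L`, where the curve need not be differentiable. -/
theorem IsChainCurve.append (hΩ : IsBoundedDomain Ω) {σ τ : ℝ → EuclideanSpace ℂ (Fin d)}
    {L M : ℝ} (hσ : IsChainCurve Ω σ L) (hτ : IsChainCurve Ω τ M) (hlink : σ L = τ 0) :
    ∃ γ, IsChainCurve Ω γ (L + M) ∧ γ 0 = σ 0 ∧ γ (L + M) = τ M := by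
  set γ : ℝ → EuclideanSpace ℂ (Fin d) := fun t => if t ≤ L then σ t else τ (t - L) with hγ
  have h1 : ∀ t, t ≤ L → γ t = σ t := fun t ht => if_pos ht
  have h2 : ∀ t, L ≤ t → γ t = τ (t - L) := fun t ht => by
    rcases eq_or_lt_of_le ht with rfl | h
    · rw [h1 L le_rfl, hlink, sub_self]
    · exact if_neg (not_le.2 h)
  have hL := hσ.nonneg
  have hM := hτ.nonneg
  have hmem : ∀ t, 0 ≤ t → t ≤ L + M → γ t ∈ Ω := fun t h0 ht => by
    rcases le_total t L with h | h
    · rw [h1 t h]; exact hσ.mem t h0 h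
    · rw [h2 t h]; exact hτ.mem _ (by linarith) (by linarith)
  have hK1 : ∀ a b, 0 ≤ a → a ≤ b → b ≤ L → kobayashiDist Ω (γ a) (γ b) ≤ b - a :=
    fun a b ha hab hb => by
      rw [h1 a (hab.trans hb), h1 b hb]; exact hσ.kobayashiDist_le a b ha hab hb
  have hK2 : ∀ a b, L ≤ a → a ≤ b → b ≤ L + M → kobayashiDist Ω (γ a) (γ b) ≤ b - a :=
    fun a b ha hab hb => by
      rw [h2 a ha, h2 b (ha.trans hab)]
      exact (hτ.kobayashiDist_le _ _ (by linarith) (by linarith) (by linarith)).trans_eq (by ring)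
  have hN1 : ∀ a b C, 0 ≤ a → a ≤ b → b ≤ L → 0 ≤ C →
      (∀ t ∈ Icc a b, growth Ω (bdryDist Ω (γ t)) ≤ ENNReal.ofReal C) →
      ‖γ b - γ a‖ ≤ C * (b - a) := fun a b C ha hab hb hC hg => by
    rw [h1 a (hab.trans hb), h1 b hb]
    refine hσ.norm_sub_le a b C ha hab hb hC fun t ht => ?_
    rw [← h1 t (ht.2.trans hb)]; exact hg t ht
  have hN2 : ∀ a b C, L ≤ a → a ≤ b → b ≤ L + M → 0 ≤ C →
      (∀ t ∈ Icc a b, growth Ω (bdryDist Ω (γ t)) ≤ ENNReal.ofReal C) →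
      ‖γ b - γ a‖ ≤ C * (b - a) := fun a b C ha hab hb hC hg => by
    rw [h2 a ha, h2 b (ha.trans hab)]
    refine (hτ.norm_sub_le (a - L) (b - L) C (by linarith) (by linarith) (by linarith) hC
      fun t ht => ?_).trans_eq (by ring)
    have := hg (t + L) ⟨by linarith [ht.1], by linarith [ht.2]⟩
    rwa [h2 _ (by linarith [ht.1]), add_sub_cancel_right] at this
  refine ⟨γ, ⟨by linarith, hmem, fun a b ha hab hb => ?_, fun a b C ha hab hb hC hg => ?_⟩,
    h1 0 hL, by rw [h2 _ (by linarith), add_sub_cancel_left]⟩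
  · rcases le_total b L with hbL | hbL
    · exact hK1 a b ha hab hbL
    rcases le_total a L with haL | haL
    · have := kobayashiDist_triangle hΩ (hmem a ha (hab.trans hb)) (hmem L hL (by linarith))
        (hmem b (ha.trans hab) hb)
      linarith [hK1 a L ha haL le_rfl, hK2 L b le_rfl hbL hb]
    · exact hK2 a b haL hab hb
  · rcases le_total b L with hbL | hbL
    · exact hN1 a b C ha hab hbL hC hg
    rcases le_total a L with haL | haL
    · have e1 := hN1 a L C ha haL le_rfl hC fun t ht => hg t ⟨ht.1, ht.2.trans hbL⟩
      have e2 := hN2 L b C le_rfl hbL hb hC fun t ht => hg t ⟨haL.trans ht.1, ht.2⟩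
      calc ‖γ b - γ a‖ ≤ ‖γ b - γ L‖ + ‖γ L - γ a‖ := norm_sub_le_norm_sub_add_norm_sub _ _ _
        _ ≤ C * (b - L) + C * (L - a) := add_le_add e2 e1
        _ = C * (b - a) := by ring
    · exact hN2 a b C haL hab hb hC hg

/-- These curves replace geodesics, and also the description of `K_Ω` as the integrated form of
`k_Ω`. -/
theorem exists_isChainCurve (hΩ : IsBoundedDomain Ω) {x y : EuclideanSpace ℂ (Fin d)} {L : ℝ}
    (hL : L ∈ chainLengths Ω x y) : ∃ σ, IsChainCurve Ω σ L ∧ σ 0 = x ∧ σ L = y := by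
  obtain ⟨n, φ, ζ, hc, rfl⟩ := hL
  obtain ⟨n, rfl⟩ : ∃ m, n = m + 1 := ⟨n - 1, by have := hc.one_le; omega⟩
  induction n generalizing y with
  | zero =>
    obtain ⟨σ, hσ, h0, h1⟩ := exists_isChainCurve_of_isHolDisk (hc.hol 1 le_rfl le_rfl)
      (hc.mem_disk 0 (by omega)) (hc.mem_disk 1 (by omega))
    have e : ∑ i ∈ Finset.range (0 + 1), poincareDist (ζ i) (ζ (i + 1)) =
      poincareDist (ζ 0) (ζ 1) := by simp
    rw [e]
    exact ⟨σ, hσ, h0.trans hc.start, h1.trans hc.finish⟩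
  | succ n ih =>
    have hc' : IsAnalyticChain Ω x (φ (n + 1) (ζ (n + 1))) (n + 1) φ ζ :=
      ⟨by omega, fun i hi hin => hc.hol i hi (by omega), fun i hi => hc.mem_disk i (by omega),
        hc.start, rfl, fun i hi hin => hc.link i hi (by omega)⟩
    obtain ⟨σ, hσ, h0, h1⟩ := ih hc'
    obtain ⟨τ, hτ, t0, t1⟩ := exists_isChainCurve_of_isHolDisk
      (hc.hol (n + 1 + 1) (by omega) le_rfl) (hc.mem_disk (n + 1) (by omega))
      (hc.mem_disk (n + 1 + 1) le_rfl)
    obtain ⟨γ, hγ, g0, g1⟩ := hσ.append hΩ hτ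
      (by rw [h1, t0, hc.link (n + 1) (by omega) (by omega)])
    rw [Finset.sum_range_succ]
    exact ⟨γ, hγ, g0.trans h0, g1.trans (t1.trans hc.finish)⟩

/-! ### Comparison with the Euclidean metric -/

/-- On a bounded domain the Kobayashi distance dominates the Euclidean one. -/
theorem norm_sub_le_mul_kobayashiDist (hΩ : IsBoundedDomain Ω) :
    ∃ R : ℝ, 0 < R ∧ ∀ x ∈ Ω, ∀ y ∈ Ω, ‖x - y‖ ≤ R * kobayashiDist Ω x y := by
  obtain ⟨R, hR, hg⟩ := exists_growth_le hΩ
  refine ⟨R, hR, fun x hx y hy => ?_⟩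
  rw [← div_le_iff₀' hR]
  refine le_csInf (chainLengths_nonempty hΩ hx hy) fun L hL => ?_
  obtain ⟨σ, hσ, rfl, rfl⟩ := exists_isChainCurve hΩ hL
  rw [div_le_iff₀' hR, norm_sub_rev]
  simpa using hσ.norm_sub_le 0 L R le_rfl hσ.nonneg le_rfl hR.le fun t _ => hg _

theorem IsChainCurve.continuousOn (hΩ : IsBoundedDomain Ω) {σ : ℝ → EuclideanSpace ℂ (Fin d)}
    {L : ℝ} (h : IsChainCurve Ω σ L) : ContinuousOn σ (Icc 0 L) := by
  obtain ⟨R, hR, hg⟩ := exists_growth_le hΩ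
  refine (LipschitzOnWith.of_dist_le_mul (K := R.toNNReal) fun s hs t ht => ?_).continuousOn
  rw [Real.coe_toNNReal _ hR.le]
  wlog hst : s ≤ t generalizing s t
  · rw [dist_comm, dist_comm s]
    exact this t ht s hs (le_of_not_ge hst)
  rw [dist_comm, dist_comm s, dist_eq_norm, Real.dist_eq, abs_of_nonneg (by linarith)]
  exact h.norm_sub_le s t R hs.1 hst ht.2 hR.le fun _ _ => hg _

/-- The Kobayashi distance of a bounded domain induces the Euclidean topology. -/
@[reducible]
noncomputable def kobayashiPseudoMetricSpace (hΩ : IsBoundedDomain Ω) : PseudoMetricSpace Ω :=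
  -- The metric is built over the existing subspace topology, so compactness, closure and continuity
  -- have the same meaning for both distances.
  .ofDistTopology (fun x y => kobayashiDist Ω x y) (fun x => kobayashiDist_self x.2)
    (fun x y => kobayashiDist_comm _ _) (fun x y z => kobayashiDist_triangle hΩ x.2 y.2 z.2) <| by
      intro s
      rw [Metric.isOpen_iff]
      refine forall₂_congr fun x _ => ⟨fun ⟨ε, hε, h⟩ => ?_, fun ⟨ε, hε, h⟩ => ?_⟩
      · obtain ⟨R, hR, hRK⟩ := norm_sub_le_mul_kobayashiDist hΩ
        refine ⟨ε / R, by positivity, fun y hy => h ?_⟩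
        rw [Metric.mem_ball, dist_comm, Subtype.dist_eq, dist_eq_norm]
        exact (hRK x x.2 y y.2).trans_lt ((lt_div_iff₀' hR).1 hy)
      · obtain ⟨r, hr, hrΩ⟩ := Metric.nhds_basis_closedBall.mem_iff.1 (hΩ.isOpen.mem_nhds x.2)
        have ht : 0 < Real.tanh ε := by
          rw [Real.tanh_eq_sinh_div_cosh]
          exact div_pos (Real.sinh_pos_iff.2 hε) (Real.cosh_pos _)
        refine ⟨r * Real.tanh ε, by positivity, fun y hy => h y ?_⟩
        rw [Metric.mem_ball, Subtype.dist_eq, dist_eq_norm] at hy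
        exact kobayashiDist_lt_of_dist_lt hr hrΩ hy

/-! ### Visibility of almost-geodesics -/

/-- The measure `dr / r` gives every shell between consecutive geometric scales a mass of at least
`1 - q`, so by monotonicity each shell contributes at least `1 - q` times the value at its inner
radius. -/
theorem tsum_geometric_ne_top_of_lintegral {g : ℝ → ℝ≥0∞} (hg : Monotone g) {ε q : ℝ} (hε : 0 < ε)
    (hint : ∫⁻ r in Ioo (0 : ℝ) ε, ENNReal.ofReal (1 / r) * g r < ∞) (hq0 : 0 < q) (hq1 : q < 1) :
    ∑' k : ℕ, g (ε * q ^ (k + 1)) ≠ ∞ := by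
  set s : ℕ → ℝ := fun k => ε * q ^ k with hs
  have hspos : ∀ k, 0 < s k := fun k => by positivity
  have hanti : Antitone s := fun i j hij =>
    mul_le_mul_of_nonneg_left (pow_le_pow_of_le_one hq0.le hq1.le hij) hε.le
  have hpiece : ∀ k, ENNReal.ofReal (1 - q) * g (s (k + 1)) ≤
      ∫⁻ r in Ioo (s (k + 1)) (s k), ENNReal.ofReal (1 / r) * g r := fun k => by
    calc ENNReal.ofReal (1 - q) * g (s (k + 1))
        = ∫⁻ _ in Ioo (s (k + 1)) (s k), ENNReal.ofReal (1 / s k) * g (s (k + 1)) := by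
          rw [setLIntegral_const, Real.volume_Ioo, mul_right_comm,
            ← ENNReal.ofReal_mul (by have := hspos k; positivity)]
          congr 2
          have := (hspos k).ne'
          have e : s (k + 1) = s k * q := by simp only [hs]; ring
          rw [e]
          field_simp
      _ ≤ _ := by
          refine setLIntegral_mono' measurableSet_Ioo fun r hr => ?_
          have hr0 := (hspos (k + 1)).trans hr.1
          exact mul_le_mul' (ENNReal.ofReal_le_ofReal (one_div_le_one_div_of_le hr0 hr.2.le))
            (hg hr.1.le)
  have hsum : ENNReal.ofReal (1 - q) * ∑' k, g (s (k + 1)) < ∞ := by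
    rw [← ENNReal.tsum_mul_left]
    refine (ENNReal.tsum_le_tsum hpiece).trans_lt ?_
    have hdisj : Pairwise (Function.onFun Disjoint fun k => Ioo (s (k + 1)) (s k)) :=
      hanti.pairwise_disjoint_on_Ioo_succ
    rw [← lintegral_iUnion (fun _ => measurableSet_Ioo) hdisj]
    refine (lintegral_mono_set (iUnion_subset fun k => Ioo_subset_Ioo (hspos _).le ?_)).trans_lt
      hint
    simpa [hs] using hanti (Nat.zero_le k)
  intro h
  rw [show ∑' k, g (s (k + 1)) = ∞ from h, ENNReal.mul_top] at hsum
  · exact lt_irrefl _ hsum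
  · simpa using hq1

/-- An excess over the distance on a subinterval is also an excess for the whole curve, so it is at
most `κ`. -/
theorem IsChainCurve.sub_le_kobayashiDist (hΩ : IsBoundedDomain Ω)
    {σ : ℝ → EuclideanSpace ℂ (Fin d)} {L κ : ℝ} (h : IsChainCurve Ω σ L)
    (hL : L ≤ kobayashiDist Ω (σ 0) (σ L) + κ) {a b : ℝ} (ha : 0 ≤ a) (hab : a ≤ b) (hb : b ≤ L) :
    b - a - κ ≤ kobayashiDist Ω (σ a) (σ b) := by
  have m0 := h.mem 0 le_rfl h.nonneg
  have mL := h.mem L h.nonneg le_rfl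
  have ma := h.mem a ha (hab.trans hb)
  have mb := h.mem b (ha.trans hab) hb
  have t1 := kobayashiDist_triangle hΩ m0 ma mL
  have t2 := kobayashiDist_triangle hΩ ma mb mL
  have e1 := h.kobayashiDist_le 0 a le_rfl ha (hab.trans hb)
  have e2 := h.kobayashiDist_le b L (ha.trans hab) hb le_rfl
  linarith

theorem bdryDist_nonneg (x : EuclideanSpace ℂ (Fin d)) : 0 ≤ bdryDist Ω x := Metric.infDist_nonneg

/-- If an almost-geodesic stays close to the boundary, then its Euclidean size, measured from its
deepest point, is small. -/
theorem IsGoldilocks.norm_sub_lt_of_bdryDist_lt (hG : IsGoldilocks Ω) {c : ℝ} (hc : 0 < c) :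
    ∃ δ₀ > 0, ∀ (σ : ℝ → EuclideanSpace ℂ (Fin d)) (L : ℝ), IsChainCurve Ω σ L →
      L ≤ kobayashiDist Ω (σ 0) (σ L) + 1 → ∀ t₀ ∈ Icc 0 L,
      (∀ t ∈ Icc 0 L, bdryDist Ω (σ t) ≤ bdryDist Ω (σ t₀)) → bdryDist Ω (σ t₀) < δ₀ →
      ‖σ L - σ t₀‖ < c := by
  have hΩ := hG.isBoundedDomain
  obtain ⟨o, ho⟩ := hΩ.isConnected.nonempty
  obtain ⟨C, α, hC, hα, hK⟩ := hG.dist_le o ho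
  obtain ⟨ε, hε, hint⟩ := hG.integral_finite
  -- The triangle inequality through `o` and the maximality at `t₀` give `t - t₀ - 1 ≤ 2 * C + 2 * α
  -- * log (1 / δ)` with `δ` the boundary distance at time `t`: this upper bound on `δ` shrinks by
  -- the factor `q` per unit of time.
  set q := Real.exp (-(1 / (2 * α))) with hq
  have hq0 : 0 < q := Real.exp_pos _
  have hq1 : q < 1 := by
    rw [hq, Real.exp_lt_one_iff, neg_neg_iff_pos]
    positivity
  set G : ℕ → ℝ≥0∞ := fun k => growth Ω (ε * q ^ (k + 1)) with hGdef
  have hsum : ∑' k, G k ≠ ∞ :=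
    tsum_geometric_ne_top_of_lintegral (fun _ _ => growth_mono) hε hint hq0 hq1
  have hfin : ∀ k, G k ≠ ∞ := ENNReal.ne_top_of_tsum_ne_top hsum
  obtain ⟨N, hN⟩ := ((ENNReal.tendsto_sum_nat_add G hsum).eventually_lt_const
    (ENNReal.ofReal_pos.2 (half_pos hc))).exists
  -- `T₀` absorbs the additive constants of the decay estimate. Waiting `N` longer leaves only a
  -- tail of the series, below `c / 2`; `N'` then makes the speed so small that the initial stretch
  -- of duration `T` also contributes less than `c / 2`.
  obtain ⟨T₀, hT₀, hT₀'⟩ : ∃ T₀ : ℝ, 0 ≤ T₀ ∧ 2 + 2 * C - 2 * α * Real.log ε ≤ T₀ :=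
    ⟨max 0 _, le_max_left _ _, le_max_right _ _⟩
  set T := T₀ + N with hT
  have hTnn : 0 ≤ T := by positivity
  have hcT : 0 < c / (2 * (T + 1)) := by positivity
  obtain ⟨N', hN'⟩ := ((ENNReal.tendsto_atTop_zero_of_tsum_ne_top hsum).eventually_lt_const
    (ENNReal.ofReal_pos.2 hcT)).exists
  refine ⟨ε * q ^ (N' + 1), by positivity, fun σ L hσ hL t₀ ht₀ hmax hlt => ?_⟩
  -- exponential decay of the boundary distance away from the deepest point
  have hdecay : ∀ t, t₀ ≤ t → t ≤ L → ∀ k : ℕ, t₀ + T + k ≤ t →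
      bdryDist Ω (σ t) ≤ ε * q ^ (k + N + 1) := by
    intro t h1 h2 k hk
    have htI : t ∈ Icc 0 L := ⟨ht₀.1.trans h1, h2⟩
    -- At boundary distance 0 the logarithm is a default value, but the bound is trivial.
    rcases (bdryDist_nonneg (Ω := Ω) (σ t)).eq_or_lt with h0 | h0
    · rw [← h0]; positivity
    have m0 := hσ.mem t₀ ht₀.1 ht₀.2
    have m1 := hσ.mem t htI.1 h2
    have e1 := hσ.sub_le_kobayashiDist hΩ hL ht₀.1 h1 h2
    have e2 := kobayashiDist_triangle hΩ m0 ho m1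
    rw [kobayashiDist_comm _ o] at e2
    have e3 := hK _ m0
    have e4 := hK _ m1
    have e5 : Real.log (1 / bdryDist Ω (σ t₀)) ≤ Real.log (1 / bdryDist Ω (σ t)) :=
      Real.log_le_log (by have := h0.trans_le (hmax t htI); positivity)
        (one_div_le_one_div_of_le h0 (hmax t htI))
    rw [one_div, Real.log_inv] at e3 e4 e5
    rw [one_div, Real.log_inv] at e5
    have e6 : α * -Real.log (bdryDist Ω (σ t₀)) ≤ α * -Real.log (bdryDist Ω (σ t)) :=
      mul_le_mul_of_nonneg_left e5 hα.le
    have e7 : 2 * α * Real.log (bdryDist Ω (σ t)) ≤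
        2 * α * Real.log ε - (k + N + 1) := by
      simp only [hT] at hk
      nlinarith
    rw [← Real.log_le_log_iff h0 (by positivity), Real.log_mul hε.ne' (by positivity),
      Real.log_pow, hq, Real.log_exp]
    refine le_of_mul_le_mul_left (e7.trans_eq ?_) (by positivity : 0 < 2 * α)
    push_cast
    field_simp
    ring
  have hstart : ∀ s, t₀ ≤ s → s ≤ L → s ≤ t₀ + T → ‖σ s - σ t₀‖ < c / 2 := by
    intro s h1 h2 h3
    have h := hσ.norm_sub_le t₀ s (c / (2 * (T + 1))) ht₀.1 h1 h2 hcT.le fun t ht =>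
      (growth_mono ((hmax t ⟨ht₀.1.trans ht.1, ht.2.trans h2⟩).trans hlt.le)).trans hN'.le
    refine h.trans_lt ?_
    rw [div_mul_eq_mul_div, div_lt_div_iff₀ (by positivity) two_pos]
    nlinarith
  -- Unit time steps after `t₀ + T`, capped at `L`; once the cap is reached the increments vanish.
  set s : ℕ → ℝ := fun j => min L (t₀ + T + j) with hs
  have hst : ∀ j, t₀ ≤ s j := fun j => le_min ht₀.2 (by
    have : (0 : ℝ) ≤ j := Nat.cast_nonneg j
    linarith)
  have hsL : ∀ j, s j ≤ L := fun j => min_le_left _ _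
  have hss : ∀ j, s j ≤ s (j + 1) := fun j => min_le_min_left _ (by push_cast; linarith)
  have hs1 : ∀ j, s (j + 1) - s j ≤ 1 := fun j => by
    have h : s (j + 1) ≤ t₀ + T + j + 1 := (min_le_right _ _).trans_eq (by push_cast; ring)
    have h' := hsL (j + 1)
    rcases min_choice L (t₀ + T + j) with e | e
    · linarith [show s j = L from e]
    · linarith [show s j = t₀ + T + j from e]
  have hstep : ∀ j, dist (σ (s j)) (σ (s (j + 1))) ≤ (G (j + N)).toReal := by
    intro j
    rw [dist_eq_norm, norm_sub_rev]
    rcases le_total L (t₀ + T + j) with h | h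
    · have e1 : s j = L := min_eq_left h
      have e2 : s (j + 1) = L := le_antisymm (hsL _) (e1 ▸ hss j)
      rw [e1, e2, sub_self, norm_zero]
      exact ENNReal.toReal_nonneg
    · have e1 : s j = t₀ + T + j := min_eq_right h
      refine (hσ.norm_sub_le (s j) (s (j + 1)) _ (ht₀.1.trans (hst j)) (hss j) (hsL _)
        ENNReal.toReal_nonneg fun t ht => ?_).trans
        (mul_le_of_le_one_right ENNReal.toReal_nonneg (hs1 j))
      rw [ENNReal.ofReal_toReal (hfin _)]
      exact growth_mono (hdecay t ((hst j).trans ht.1) (ht.2.trans (hsL _)) j (e1 ▸ ht.1))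
  obtain ⟨J, hJ⟩ := exists_nat_ge (L - t₀ - T)
  have hJL : s J = L := min_eq_left (by linarith)
  have htail : dist (σ (s 0)) (σ (s J)) ≤ c / 2 := by
    refine (dist_le_range_sum_of_dist_le (f := fun j => σ (s j)) J fun {k} _ => hstep k).trans ?_
    rw [← ENNReal.toReal_sum fun k _ => hfin _]
    exact ENNReal.toReal_le_of_le_ofReal (half_pos hc).le
      ((ENNReal.sum_le_tsum (f := fun k => G (k + N)) _).trans hN.le)
  rw [hJL, dist_eq_norm, norm_sub_rev] at htail
  have h0 := hstart (s 0) (hst 0) (hsL 0) ((min_le_right _ _).trans_eq (by simp))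
  calc ‖σ L - σ t₀‖ ≤ ‖σ L - σ (s 0)‖ + ‖σ (s 0) - σ t₀‖ :=
        norm_sub_le_norm_sub_add_norm_sub _ _ _
    _ < c := by linarith

/-- **Visibility**: the Gromov product of two points of a Goldilocks domain that are a definite
Euclidean distance apart is bounded. -/
theorem IsGoldilocks.exists_gromovProduct_le (hG : IsGoldilocks Ω) {o : EuclideanSpace ℂ (Fin d)}
    (ho : o ∈ Ω) {c : ℝ} (hc : 0 < c) :
    ∃ B : ℝ, ∀ x ∈ Ω, ∀ y ∈ Ω, c ≤ ‖x - y‖ →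
      kobayashiDist Ω o x + kobayashiDist Ω o y - kobayashiDist Ω x y ≤ B := by
  have hΩ := hG.isBoundedDomain
  obtain ⟨C, α, -, hα, hK⟩ := hG.dist_le o ho
  obtain ⟨δ₀, hδ₀, hvis⟩ := hG.norm_sub_lt_of_bdryDist_lt (half_pos hc)
  -- Twice the distance from `o` to a point of depth at least `δ₀`, plus the slack 1 of the
  -- almost-geodesic.
  refine ⟨2 * (C + α * Real.log (1 / δ₀)) + 1, fun x hx y hy hxy => ?_⟩
  obtain ⟨L, hLm, hL⟩ := exists_chainLength_lt hΩ hx hy (lt_add_one _)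
  obtain ⟨σ, hσ, rfl, rfl⟩ := exists_isChainCurve hΩ hLm
  obtain ⟨t₀, ht₀, hmax⟩ := isCompact_Icc.exists_isMaxOn (nonempty_Icc.2 hσ.nonneg)
    ((Metric.continuous_infDist_pt (frontier Ω)).comp_continuousOn (hσ.continuousOn hΩ))
  have hmax' : ∀ t ∈ Icc 0 L, bdryDist Ω (σ t) ≤ bdryDist Ω (σ t₀) := fun t ht => hmax ht
  -- Otherwise both halves, the first one run backwards, have endpoints less than `c / 2` apart.
  have hdeep : δ₀ ≤ bdryDist Ω (σ t₀) := by
    by_contra! hlt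
    have h1 := hvis σ L hσ hL.le t₀ ht₀ hmax' hlt
    have h2 := hvis _ L hσ.reverse (by simpa [kobayashiDist_comm (σ L)] using hL.le) (L - t₀)
      ⟨by linarith [ht₀.2], by linarith [ht₀.1]⟩
      (fun t ht => by simpa using hmax' (L - t) ⟨by linarith [ht.2], by linarith [ht.1]⟩)
      (by simpa using hlt)
    simp only [sub_self, sub_sub_cancel] at h2
    rw [norm_sub_rev] at h1
    linarith [norm_sub_le_norm_sub_add_norm_sub (σ 0) (σ t₀) (σ L)]
  have mz := hσ.mem t₀ ht₀.1 ht₀.2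
  have e1 := hσ.kobayashiDist_le 0 t₀ le_rfl ht₀.1 ht₀.2
  have e2 := hσ.kobayashiDist_le t₀ L ht₀.1 ht₀.2 le_rfl
  have t1 := kobayashiDist_triangle hΩ ho mz hx
  have t2 := kobayashiDist_triangle hΩ ho mz hy
  rw [kobayashiDist_comm (σ t₀)] at t1
  have e3 := hK _ mz
  have e4 : α * Real.log (1 / bdryDist Ω (σ t₀)) ≤ α * Real.log (1 / δ₀) :=
    mul_le_mul_of_nonneg_left (Real.log_le_log (by have := hδ₀.trans_le hdeep; positivity)
      (one_div_le_one_div_of_le hδ₀ hdeep)) hα.le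
  linarith

/-! ### Properness and iteration -/

/-- By Hopf–Rinow, the Kobayashi distance of a bounded, Cauchy complete domain is proper. -/
theorem properSpace_kobayashi (hΩ : IsBoundedDomain Ω) (hc : IsKobayashiComplete Ω) :
    @ProperSpace Ω (kobayashiPseudoMetricSpace hΩ) := by
  have hloc : LocallyCompactSpace Ω := hΩ.isOpen.locallyCompactSpace
  let m := kobayashiPseudoMetricSpace hΩ
  have : @CompleteSpace Ω m.toUniformSpace := by
    refine @Metric.complete_of_cauchySeq_tendsto Ω m fun u hu => ?_
    obtain ⟨x, hx, hlim⟩ := hc (fun n => u n) (fun n => (u n).2) ((@Metric.cauchySeq_iff Ω ℕ m _ _ u).1 hu)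
    exact ⟨⟨x, hx⟩, (@tendsto_iff_dist_tendsto_zero Ω ℕ m u atTop ⟨x, hx⟩).2 hlim⟩
  refine @properSpace_of_length Ω m this hloc fun x y r s hr hs hxy => ?_
  obtain ⟨L, hLm, hL⟩ := exists_chainLength_lt hΩ x.2 y.2 hxy
  obtain ⟨σ, hσ, h0, h1⟩ := exists_isChainCurve hΩ hLm
  have hm0 : 0 ≤ min r L := le_min hr hσ.nonneg
  have e1 := hσ.kobayashiDist_le 0 (min r L) le_rfl hm0 (min_le_right _ _)
  have e2 := hσ.kobayashiDist_le (min r L) L hm0 (min_le_right _ _) le_rfl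
  -- The splitting point is reached at time `r` along a chain curve of length less than `r + s`, or
  -- at its end if the curve is shorter.
  refine ⟨⟨σ (min r L), hσ.mem _ hm0 (min_le_right _ _)⟩, ?_, ?_⟩
  · change kobayashiDist Ω x (σ (min r L)) ≤ r
    rw [h0] at e1
    linarith [min_le_left r L]
  · change kobayashiDist Ω (σ (min r L)) y < s
    rw [h1] at e2
    rcases min_choice r L with h | h <;> rw [h] at e2 ⊢ <;> linarith

theorem continuous_kobayashiDist (hΩ : IsBoundedDomain Ω) (o : Ω) :
    Continuous fun x : Ω => kobayashiDist Ω o x :=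
  letI := kobayashiPseudoMetricSpace hΩ
  (continuous_const.dist continuous_id : Continuous fun x : Ω => dist o x)

theorem kobayashiDist_iterate_le {f : Ω → Ω}
    (hf : ∀ x y : Ω, kobayashiDist Ω (f x) (f y) ≤ kobayashiDist Ω x y) (n : ℕ) (x y : Ω) :
    kobayashiDist Ω (f^[n] x) (f^[n] y) ≤ kobayashiDist Ω x y := by
  induction n with
  | zero => exact le_rfl
  | succ n ih =>
    rw [Function.iterate_succ_apply', Function.iterate_succ_apply']
    exact (hf _ _).trans ih

/-- If one orbit escapes to infinity, then all orbits converge to the same boundary point, locally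
uniformly. -/
theorem IsGoldilocks.exists_tendstoUniformlyOn_iterate (hΩ : IsGoldilocks Ω) {f : Ω → Ω}
    (hf : ∀ x y : Ω, kobayashiDist Ω (f x) (f y) ≤ kobayashiDist Ω x y) {o : Ω}
    (ho : Tendsto (fun n : ℕ => kobayashiDist Ω o (f^[n] o)) atTop atTop) :
    ∃ ξ ∈ frontier Ω, ∀ L : Set Ω, IsCompact L →
      TendstoUniformlyOn (fun (n : ℕ) (x : Ω) => ((f^[n] x : Ω) : EuclideanSpace ℂ (Fin d)))
        (fun _ => ξ) atTop L := by
  have hB := hΩ.isBoundedDomain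
  set a : ℕ → EuclideanSpace ℂ (Fin d) := fun n => ((f^[n] o : Ω) : EuclideanSpace ℂ (Fin d))
    with ha
  have haΩ : ∀ n, a n ∈ Ω := fun n => (f^[n] o).2
  have hcauchy : CauchySeq a := by
    rw [Metric.cauchySeq_iff]
    intro c hc
    obtain ⟨B, hBc⟩ := hΩ.exists_gromovProduct_le o.2 (half_pos hc)
    obtain ⟨N, hN⟩ := eventually_atTop.1 (ho.eventually_gt_atTop B)
    -- At a record time `ν`, `K(a m, a ν) ≤ K(o, a (ν - m)) ≤ K(o, a ν)`. The Gromov expression of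
    -- `a m` and `a ν` is thus at least `K(o, a m) > B`, so visibility forces them together.
    have hrecord : ∀ ν, (∀ k < ν, kobayashiDist Ω o (a k) < kobayashiDist Ω o (a ν)) →
        ∀ m, N ≤ m → m ≤ ν → ‖a m - a ν‖ < c / 2 := by
      intro ν hν m hNm hmν
      by_contra! hfar
      have h1 := hBc _ (haΩ m) _ (haΩ ν) hfar
      have h2 : kobayashiDist Ω (a m) (a ν) ≤ kobayashiDist Ω o (a (ν - m)) := by
        have := kobayashiDist_iterate_le hf m o (f^[ν - m] o)
        rwa [← Function.iterate_add_apply, Nat.add_sub_cancel' hmν] at this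
      have h3 : kobayashiDist Ω o (a (ν - m)) ≤ kobayashiDist Ω o (a ν) := by
        rcases Nat.eq_zero_or_pos m with rfl | hm
        · exact le_rfl
        · exact (hν _ (by omega)).le
      have h4 : B < kobayashiDist Ω o (a m) := hN m hNm
      linarith
    refine ⟨N, fun m hm n hn => ?_⟩
    -- Escape provides arbitrarily late records, so `m` and `n` can be compared with the same one.
    obtain ⟨ν, hνge, hν⟩ := high_scores ho (max m n)
    have h1 := hrecord ν hν m hm ((le_max_left _ _).trans hνge)
    have h2 := hrecord ν hν n hn ((le_max_right _ _).trans hνge)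
    rw [dist_eq_norm]
    rw [norm_sub_rev] at h2
    linarith [norm_sub_le_norm_sub_add_norm_sub (a m) (a ν) (a n)]
  obtain ⟨ξ, hξ⟩ := cauchySeq_tendsto_of_complete hcauchy
  have hξΩ : ξ ∉ Ω := fun h => by
    have hlim : Tendsto (fun n : ℕ => f^[n] o) atTop (𝓝 (⟨ξ, h⟩ : Ω)) := tendsto_subtype_rng.2 hξ
    exact not_tendsto_nhds_of_tendsto_atTop ho _
      (((continuous_kobayashiDist hB o).tendsto _).comp hlim)
  refine ⟨ξ, ?_, fun L hL => ?_⟩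
  · rw [hB.isOpen.frontier_eq]
    exact ⟨mem_closure_of_tendsto hξ (Eventually.of_forall haΩ), hξΩ⟩
  · rw [Metric.tendstoUniformlyOn_iff]
    intro c hc
    obtain ⟨R, hR⟩ := hL.bddAbove_image (continuous_kobayashiDist hB o).continuousOn
    obtain ⟨B, hBc⟩ := hΩ.exists_gromovProduct_le o.2 (half_pos hc)
    -- On `L`, `f^[n] x` stays within `R` of `a n`, so their Gromov expression is at least `2 * K(o,
    -- a n) - 2 * R`, which this threshold pushes above `B`.
    filter_upwards [ho.eventually_gt_atTop (B / 2 + R),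
      (Metric.tendsto_nhds.1 hξ) (c / 2) (half_pos hc)] with n hn hnξ x hx
    have hxR : kobayashiDist Ω o x ≤ R := hR (mem_image_of_mem _ hx)
    have h1 := (kobayashiDist_iterate_le hf n o x).trans hxR
    have h2 := kobayashiDist_triangle hB o.2 (f^[n] x).2 (f^[n] o).2
    rw [kobayashiDist_comm (f^[n] x : EuclideanSpace ℂ (Fin d))] at h2
    have hnear : ‖a n - f^[n] x‖ < c / 2 := by
      by_contra! hfar
      have h3 := hBc _ (haΩ n) _ (f^[n] x).2 hfar
      simp only [ha] at h3
      linarith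
    rw [dist_comm, dist_eq_norm] at hnξ
    rw [dist_eq_norm]
    linarith [norm_sub_le_norm_sub_add_norm_sub ξ (a n) (f^[n] x : EuclideanSpace ℂ (Fin d))]

end Goldilocks

open Goldilocks in
theorem theorem1p5 {d : ℕ} (Ω : Set (EuclideanSpace ℂ (Fin d)))
    (hΩ : Goldilocks.IsGoldilocks Ω) (hcomplete : Goldilocks.IsKobayashiComplete Ω)
    (f : Ω → Ω)
    (hf : ∀ x y : Ω, Goldilocks.kobayashiDist Ω (f x) (f y) ≤ Goldilocks.kobayashiDist Ω x y) :
    (∀ x : Ω, IsCompact (closure (Set.range fun n : ℕ => f^[n] x))) ∨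
    (∃ ξ ∈ frontier Ω,
      (∀ x : Ω, Tendsto (fun n : ℕ => ((f^[n] x : Ω) : EuclideanSpace ℂ (Fin d))) atTop (𝓝 ξ)) ∧
      ∀ L : Set Ω, IsCompact L →
        TendstoUniformlyOn (fun (n : ℕ) (x : Ω) => ((f^[n] x : Ω) : EuclideanSpace ℂ (Fin d)))
          (fun _ => ξ) atTop L) := by
  have hB := hΩ.isBoundedDomain
  have hproper := properSpace_kobayashi hB hcomplete
  -- The bornology is given explicitly: for the Euclidean one every orbit is bounded.
  by_cases h : ∀ x : Ω, @Bornology.IsBounded Ω (kobayashiPseudoMetricSpace hB).toBornology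
      (range fun n : ℕ => f^[n] x)
  · left
    intro x
    let := kobayashiPseudoMetricSpace hB
    exact Metric.isCompact_of_isClosed_isBounded isClosed_closure (h x).closure
  · right
    obtain ⟨o, ho⟩ := not_forall.1 h
    have hesc := @tendsto_dist_iterate_atTop Ω (kobayashiPseudoMetricSpace hB) hproper f hf o ho
    obtain ⟨ξ, hξ, hunif⟩ := hΩ.exists_tendstoUniformlyOn_iterate hf hesc
    exact ⟨ξ, hξ, fun x => (hunif {x} isCompact_singleton).tendsto_at rfl, hunif⟩
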